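/- For $k\in\mathbb{C}$ let $\mathrm{sn}(z)=\mathrm{sn}(z,k)$ be the Jacobi sine amplitude, i.e. the inverse near $0$ of $w\mapsto\int_0^w \frac{dt}{\sqrt{(1-t^2)(1-k^2t^2)}}$, and put $$\mathrm{ns}^2=\frac1{\mathrm{sn}^2},\qquad \mathrm{nc}^2=\frac1{1-\mathrm{sn}^2},\qquad \mathrm{dn}^2=1-k^2\,\mathrm{sn}^2,\qquad \mathrm{nd}^2=\frac1{1-k^2\,\mathrm{sn}^2}.$$ Define $c_j(k),d_j(k),e_j(k),f_j(k)$ for $j\ge1$ by the expansions at $z=0$ $$\mathrm{ns}^2(z)-\frac1{z^2}-\frac{1+k^2}{3}=\sum_{j\ge1}c_j(k)z^{2j},\qquad (1-k^2)(\mathrm{nd}^2(z)-1)=\sum_{j\ge1}d_j(k)z^{2j},$$ $$(1-k^2)(\mathrm{nc}^2(z)-1)=\sum_{j\ge1}e_j(k)z^{2j},\qquad \mathrm{dn}^2(z)-1=\sum_{j\ge1}f_j(k)z^{2j},$$ and let $\Theta_j^{\pm}=c_j\pm d_j$ and $\Lambda_j^{\pm}=e_j\pm f_j$. (1) For every $j\ge1$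 the functions $\Theta_j^\pm,\Lambda_j^\pm$ are polynomials in $k^2$ with rational coefficients, and the $\mathbb{Q}$-vector space $$S_j=\{t\in\mathbb{Q}^4:\ -t_1\Theta_j^-+t_2\Theta_j^+-t_3\Lambda_j^-+t_4\Lambda_j^+=0 \text{ identically in } k\}$$ is one-dimensional, spanned by $(1-2^{2j+1},\,2^{2j+1},\,1,\,0)$. (2) Let $k\in\mathbb{C}\setminus\{0,\pm1\}$, let $K=\int_0^1\frac{dt}{\sqrt{(1-t^2)(1-k^2t^2)}}$, and for $j\ge2$ let $$(x_{4j-3},x_{4j-2},x_{4j-1},x_{4j})=\Big(\frac{2K}{\pi}\Big)^{2j}\cdot\begin{cases}(\Theta_{j-1}^-(k),\Theta_{j-1}^+(k),\Lambda_{j-1}^-(k),\Lambda_{j-1}^+(k)), & j\text{ even},\\ (\Theta_{j-1}^+(k),\Theta_{j-1}^-(k),\Lambda_{j-1}^+(k),\Lambda_{j-1}^-(k)), & j\text{ odd}.\end{cases}$$ Then $x_{4j-3},x_{4j-2},x_{4j-1}$ are linearly dependent over $\mathbb{Q}$ for every even $j\ge2$, and $x_{4j-3},x_{4j-2},x_{4j}$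 are linearly dependent over $\mathbb{Q}$ for every odd $j\ge3$. -/

import Mathlib

namespace JacobiAux

open scoped Topology

noncomputable section

/-- The elliptic integral `∫₀ʷ dt / √((1 - t²)(1 - k²t²))` along the straight segment from `0` to
`w`, with the principal branch of the square root (the integrand is holomorphic for `t` near `0`,
with value `1` at `t = 0`). -/
def ellipticF (k w : ℂ) : ℂ :=
  ∫ s in (0 : ℝ)..1, w * (1 / ((1 - (s * w) ^ 2) * (1 - k ^ 2 * (s * w) ^ 2)) ^ (1 / 2 : ℂ))

theorem ellipticF_aux (k : ℂ) :
    AnalyticAt ℂ (ellipticF k) 0 ∧ HasDerivAt (ellipticF k) 1 0 := by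
  set p : ℂ → ℂ := fun t => (1 - t ^ 2) * (1 - k ^ 2 * t ^ 2) with hp
  set g : ℂ → ℂ := fun t => 1 / (p t) ^ (1 / 2 : ℂ) with hg
  have hpc : Continuous p := by fun_prop
  have hp0 : p 0 = 1 := by simp [hp]
  have hev : ∀ᶠ t in 𝓝 (0 : ℂ), p t ∈ Complex.slitPlane := by
    apply hpc.continuousAt.eventually
    rw [hp0]
    exact Complex.isOpen_slitPlane.mem_nhds Complex.one_mem_slitPlane
  obtain ⟨r, hr, hball⟩ := Metric.eventually_nhds_iff_ball.1 hev
  have hgd : DifferentiableOn ℂ g (Metric.ball 0 r) := by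
    intro t ht
    have h1 : DifferentiableAt ℂ (fun t => p t ^ (1 / 2 : ℂ)) t :=
      DifferentiableAt.cpow_const (by fun_prop) (hball t ht)
    have h2 : p t ^ (1 / 2 : ℂ) ≠ 0 := by
      rw [Complex.cpow_def_of_ne_zero (Complex.slitPlane_ne_zero (hball t ht))]
      exact Complex.exp_ne_zero _
    exact ((differentiableAt_const (1 : ℂ)).div h1 h2).differentiableWithinAt
  obtain ⟨G, hG⟩ := hgd.isExactOn_ball
  have hF : ∀ w ∈ Metric.ball (0 : ℂ) r, ellipticF k w = G w - G 0 := by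
    intro w hw
    have hsw : ∀ s ∈ Set.uIcc (0 : ℝ) 1, (s : ℂ) * w ∈ Metric.ball (0 : ℂ) r := by
      intro s hs
      rw [Set.uIcc_of_le zero_le_one] at hs
      rw [mem_ball_zero_iff] at hw ⊢
      rw [norm_mul, Complex.norm_real, Real.norm_of_nonneg hs.1]
      exact lt_of_le_of_lt (mul_le_of_le_one_left (norm_nonneg _) hs.2) hw
    have hd : ∀ s ∈ Set.uIcc (0 : ℝ) 1,
        HasDerivAt (fun s : ℝ => G ((s : ℂ) * w)) (w * g ((s : ℂ) * w)) s := by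
      intro s hs
      have h1 : HasDerivAt (fun s : ℝ => (s : ℂ) * w) w s := by
        simpa using (Complex.ofRealCLM.hasDerivAt (x := s)).mul_const w
      have h2 := (hG _ (hsw s hs)).comp s h1
      simpa [mul_comm, Function.comp_def] using h2
    have hc : ContinuousOn (fun s : ℝ => w * g ((s : ℂ) * w)) (Set.uIcc (0 : ℝ) 1) := by
      refine continuousOn_const.mul (hgd.continuousOn.comp (by fun_prop) ?_)
      exact fun s hs => hsw s hs
    have := intervalIntegral.integral_eq_sub_of_hasDerivAt hd hc.intervalIntegrable
    simpa [ellipticF, hg, hp] using this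
  have hGa : AnalyticAt ℂ G 0 := by
    apply DifferentiableOn.analyticAt (s := Metric.ball 0 r)
    · exact fun t ht => (hG t ht).differentiableAt.differentiableWithinAt
    · exact Metric.ball_mem_nhds 0 hr
  have hEq : (fun w => G w - G 0) =ᶠ[𝓝 0] ellipticF k := by
    filter_upwards [Metric.ball_mem_nhds (0 : ℂ) hr] with w hw using (hF w hw).symm
  refine ⟨(hGa.sub analyticAt_const).congr hEq, ?_⟩
  have hd0 : HasDerivAt (fun w => G w - G 0) (g 0) 0 :=
    (hG 0 (Metric.mem_ball_self hr)).sub_const (G 0)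
  have hg0 : g 0 = 1 := by simp [hg, hp0]
  rw [hg0] at hd0
  exact hd0.congr_of_eventuallyEq hEq.symm

theorem analyticAt_ellipticF (k : ℂ) : AnalyticAt ℂ (ellipticF k) 0 :=
  (ellipticF_aux k).1

theorem deriv_ellipticF_ne_zero (k : ℂ) : deriv (ellipticF k) 0 ≠ 0 := by
  rw [(ellipticF_aux k).2.deriv]
  exact one_ne_zero

/-- The Jacobi sine amplitude `sn(·, k)` near `z = 0`: the local inverse at `0` of the elliptic
integral `ellipticF k`. Only its germ at `0` is meaningful, and only this germ is used below. -/
def sn (k : ℂ) : ℂ → ℂ :=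
  (analyticAt_ellipticF k).hasStrictDerivAt.localInverse _ _ _ (deriv_ellipticF_ne_zero k)

def nsSq (k z : ℂ) : ℂ := 1 / sn k z ^ 2

def ncSq (k z : ℂ) : ℂ := 1 / (1 - sn k z ^ 2)

def dnSq (k z : ℂ) : ℂ := 1 - k ^ 2 * sn k z ^ 2

def ndSq (k z : ℂ) : ℂ := 1 / (1 - k ^ 2 * sn k z ^ 2)

/-- The `n`-th Taylor coefficient of `g` at `0`. -/
def taylorCoeff (g : ℂ → ℂ) (n : ℕ) : ℂ := iteratedDeriv n g 0 / (n.factorial : ℂ)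

/-- `c_j(k)`: the coefficient of `z^(2j)` in `ns²(z) - 1/z² - (1 + k²)/3 = ∑_{j ≥ 1} c_j(k) z^(2j)`.
The left-hand side has a removable singularity at `z = 0`, where its value is `0`. -/
def c (j : ℕ) (k : ℂ) : ℂ :=
  taylorCoeff (Function.update (fun z => nsSq k z - 1 / z ^ 2 - (1 + k ^ 2) / 3) 0 0) (2 * j)

/-- `d_j(k)`: the coefficient of `z^(2j)` in `(1 - k²)(nd²(z) - 1)`. -/
def d (j : ℕ) (k : ℂ) : ℂ := taylorCoeff (fun z => (1 - k ^ 2) * (ndSq k z - 1)) (2 * j)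

/-- `e_j(k)`: the coefficient of `z^(2j)` in `(1 - k²)(nc²(z) - 1)`. -/
def e (j : ℕ) (k : ℂ) : ℂ := taylorCoeff (fun z => (1 - k ^ 2) * (ncSq k z - 1)) (2 * j)

/-- `f_j(k)`: the coefficient of `z^(2j)` in `dn²(z) - 1`. -/
def f (j : ℕ) (k : ℂ) : ℂ := taylorCoeff (fun z => dnSq k z - 1) (2 * j)

def thetaMinus (j : ℕ) (k : ℂ) : ℂ := c j k - d j k

def thetaPlus (j : ℕ) (k : ℂ) : ℂ := c j k + d j k

def lambdaMinus (j : ℕ) (k : ℂ) : ℂ := e j k - f j k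

def lambdaPlus (j : ℕ) (k : ℂ) : ℂ := e j k + f j k

/-- The vector `(-Θ_j⁻, Θ_j⁺, -Λ_j⁻, Λ_j⁺)` of functions of the modulus. -/
def auxVec (j : ℕ) : Fin 4 → ℂ → ℂ :=
  ![fun k => -thetaMinus j k, thetaPlus j, fun k => -lambdaMinus j k, lambdaPlus j]

/-- The rational vectors `t` with `⟨t, (-Θ_j⁻, Θ_j⁺, -Λ_j⁻, Λ_j⁺)⟩ = 0`, identically in `k`. -/
def S (j : ℕ) : Submodule ℚ (Fin 4 → ℚ) where
  carrier := {t | ∑ i, t i • auxVec j i = 0}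
  add_mem' := by
    intro a b ha hb
    simp only [Set.mem_ofPred_eq, Pi.add_apply, add_smul, Finset.sum_add_distrib] at *
    rw [ha, hb, add_zero]
  zero_mem' := by simp
  smul_mem' := by
    intro r a ha
    simp only [Set.mem_ofPred_eq, Pi.smul_apply, smul_eq_mul, mul_smul] at *
    rw [← Finset.smul_sum, ha, smul_zero]

/-- The vector `(1 - 2^(2j+1), 2^(2j+1), 1, 0)`. -/
def v (j : ℕ) : Fin 4 → ℚ := ![1 - 2 ^ (2 * j + 1), 2 ^ (2 * j + 1), 1, 0]

/-- The complete elliptic integral of the first kind. -/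
def K (k : ℂ) : ℂ :=
  ∫ t in (0 : ℝ)..1, 1 / ((1 - (t : ℂ) ^ 2) * (1 - k ^ 2 * (t : ℂ) ^ 2)) ^ (1 / 2 : ℂ)

/-- The complete elliptic integral of the second kind. -/
def E (k : ℂ) : ℂ :=
  ∫ t in (0 : ℝ)..1, ((1 - k ^ 2 * (t : ℂ) ^ 2) / (1 - (t : ℂ) ^ 2)) ^ (1 / 2 : ℂ)

/-- The block `(x_{4j-3}, x_{4j-2}, x_{4j-1}, x_{4j})` for `j ≥ 1`. -/
def xBlock (k : ℂ) (j : ℕ) : Fin 4 → ℂ :=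
  if j = 1 then
    ![1, (2 * K k / Real.pi) ^ 2, (2 * K k / Real.pi) ^ 2 * (2 * k ^ 2 - 1),
      (2 * K k / Real.pi) ^ 2 * (6 * E k / K k - 5 + 4 * k ^ 2)]
  else if Even j then
    fun i => (2 * K k / Real.pi) ^ (2 * j) *
      ![thetaMinus (j - 1) k, thetaPlus (j - 1) k, lambdaMinus (j - 1) k, lambdaPlus (j - 1) k] i
  else
    fun i => (2 * K k / Real.pi) ^ (2 * j) *
      ![thetaPlus (j - 1) k, thetaMinus (j - 1) k, lambdaPlus (j - 1) k, lambdaMinus (j - 1) k] i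

/-- The quantity `x_n`, `n ≥ 1`: the entry of index `(n - 1) mod 4` of block `⌊(n - 1)/4⌋ + 1`. -/
def x (k : ℂ) (n : ℕ) : ℂ := xBlock k ((n - 1) / 4 + 1) (Fin.ofNat 4 (n - 1))

end

end JacobiAux

/-!
The function `ns² - (1 + k²)/3` is a Weierstrass `℘`-function, and `k² sn² = 1 - dn²`,
`dc² = k² + (1 - k²) nc²` and `k² cd² = 1 - (1 - k²) nd²` are, up to the same additive constant,
its translates by the half-periods. In the duplication formula `4 ℘(2z) = ∑ ℘(z + ω)`, with `ω`
ranging over the 2-torsion points, the coefficient of `z^(2j)` gives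
`4 * 4^j c_j = c_j + e_j - d_j - f_j`, which is the relation `v j`.

Each of the three translates, minus its value at `0`, is the solution `w` of an equation
`w'' = a + b w + 6 w²` with `w(0) = w'(0) = 0`, where `a` and `b` are polynomials in `k²`. Solving
it recursively shows that `d_j`, `e_j` and `f_j` are polynomials in `k²`, and hence so is `c_j`.
Such a solution vanishes when `a = 0`, and its even coefficients are positive when `a, b > 0` (for
`f_j`, after replacing `z` by `iz`). So at `k = 0` only `e_j` survives, at `k = 1` only `f_j`, and
`d_j ≠ 0` when `k² = 2`: `d_j`, `e_j` and `f_j` are linearly independent over `ℚ`.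
-/

namespace JacobiAux

open scoped PowerSeries Topology
open PowerSeries
open Finset.HasAntidiagonal (antidiagonal mem_antidiagonal)

/-- `w` is the formal solution of `w'' = a + b w + c w²` with `w(0) = w'(0) = 0`. The series
`℘(z + ω) - ℘(ω)` at a half-period `ω` are of this kind, with `c = 6`. -/
structure SolvesQuadratic {R : Type*} [CommRing R] (a b c : R) (w : R⟦X⟧) : Prop where
  coeff_zero : coeff 0 w = 0
  coeff_one : coeff 1 w = 0
  derivative_derivative : d⁄dX R (d⁄dX R w) = C a + C b * w + C c * w ^ 2

theorem derivative_rescale {R : Type*} [CommRing R] (r : R) (w : R⟦X⟧) :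
    d⁄dX R (rescale r w) = C r * rescale r (d⁄dX R w) := by
  ext n
  simp only [coeff_derivative, coeff_rescale, coeff_C_mul, pow_succ]
  ring

theorem rescale_C {R : Type*} [CommSemiring R] (r a : R) : rescale r (C a) = C a := by
  ext n
  rcases eq_or_ne n 0 with rfl | hn <;> simp [coeff_C, *]

namespace SolvesQuadratic

section CommRing

variable {R : Type*} [CommRing R] {a b c : R} {v w : R⟦X⟧}

theorem zero : SolvesQuadratic 0 b c (0 : R⟦X⟧) := ⟨by simp, by simp, by simp⟩

theorem C_mul {r : R} (hw : SolvesQuadratic a b (c * r) w) :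
    SolvesQuadratic (r * a) b c (C r * w) where
  coeff_zero := by rw [coeff_C_mul, hw.coeff_zero, mul_zero]
  coeff_one := by rw [coeff_C_mul, hw.coeff_one, mul_zero]
  derivative_derivative := by
    simp only [Derivation.leibniz, derivative_C, smul_eq_mul, mul_zero, add_zero,
      hw.derivative_derivative, map_mul]
    ring

theorem neg_rescale {i : R} (hi : i ^ 2 = -1) (hw : SolvesQuadratic a b c w) :
    SolvesQuadratic a (-b) c (-rescale i w) where
  coeff_zero := by rw [map_neg, coeff_rescale, hw.coeff_zero, mul_zero, neg_zero]
  coeff_one := by rw [map_neg, coeff_rescale, hw.coeff_one, mul_zero, neg_zero]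
  derivative_derivative := by
    have hi' : (C i : R⟦X⟧) ^ 2 = -1 := by rw [← map_pow, hi, map_neg, map_one]
    simp only [map_neg, derivative_rescale, Derivation.leibniz, derivative_C, mul_zero, add_zero,
      smul_eq_mul, hw.derivative_derivative, map_add, map_mul, map_pow, rescale_C]
    linear_combination -(C a + C b * rescale i w + C c * rescale i w ^ 2) * hi'

theorem coeff_add_two_mul (hw : SolvesQuadratic a b c w) (n : ℕ) :
    coeff (n + 2) w * ((n + 2) * (n + 1)) = (if n = 0 then a else 0) + b * coeff n w
      + c * ∑ p ∈ antidiagonal n, coeff p.1 w * coeff p.2 w := by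
  have h := congrArg (coeff n) hw.derivative_derivative
  rw [coeff_derivative, coeff_derivative, sq, map_add, map_add, coeff_C_mul, coeff_C_mul, coeff_mul,
    coeff_C] at h
  rw [← h]
  push_cast
  ring

theorem eq [NoZeroDivisors R] [CharZero R] (hv : SolvesQuadratic a b c v)
    (hw : SolvesQuadratic a b c w) : v = w := by
  ext n
  induction n using Nat.strong_induction_on with
  | _ n ih =>
    match n with
    | 0 => rw [hv.coeff_zero, hw.coeff_zero]
    | 1 => rw [hv.coeff_one, hw.coeff_one]
    | n + 2 =>
      have hn : ((n : R) + 2) * (n + 1) ≠ 0 :=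
        mul_ne_zero (by exact_mod_cast (n + 1).succ_ne_zero) (by exact_mod_cast n.succ_ne_zero)
      apply mul_right_cancel₀ hn
      rw [hv.coeff_add_two_mul, hw.coeff_add_two_mul, ih n (by omega)]
      congr 2
      refine Finset.sum_congr rfl fun p hp => ?_
      have := mem_antidiagonal.1 hp
      rw [ih p.1 (by omega), ih p.2 (by omega)]

end CommRing

section Field

variable {F : Type*} [Field F]

theorem coeff_add_two [CharZero F] {a b c : F} {w : F⟦X⟧} (hw : SolvesQuadratic a b c w) (n : ℕ) :
    coeff (n + 2) w = ((if n = 0 then a else 0) + b * coeff n w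
      + c * ∑ p ∈ antidiagonal n, coeff p.1 w * coeff p.2 w) / ((n + 2) * (n + 1)) := by
  have hn : ((n : F) + 2) * (n + 1) ≠ 0 :=
    mul_ne_zero (by exact_mod_cast (n + 1).succ_ne_zero) (by exact_mod_cast n.succ_ne_zero)
  rw [eq_div_iff hn, hw.coeff_add_two_mul]

theorem coeff_mem [CharZero F] {ι : Type*} (A : Subalgebra ℚ (ι → F)) {a b c : ι → F}
    (ha : a ∈ A) (hb : b ∈ A) (hc : c ∈ A) {w : ι → F⟦X⟧}
    (hw : ∀ i, SolvesQuadratic (a i) (b i) (c i) (w i)) (n : ℕ) :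
    (fun i => coeff n (w i)) ∈ A := by
  induction n using Nat.strong_induction_on with
  | _ n ih =>
    match n with
    | 0 => exact (funext fun i => (hw i).coeff_zero : _ = (0 : ι → F)) ▸ A.zero_mem
    | 1 => exact (funext fun i => (hw i).coeff_one : _ = (0 : ι → F)) ▸ A.zero_mem
    | n + 2 =>
      have hsum : ∑ p ∈ antidiagonal n,
          (fun i => coeff p.1 (w i)) * (fun i => coeff p.2 (w i)) ∈ A := by
        refine A.sum_mem fun p hp => ?_
        have := mem_antidiagonal.1 hp
        exact A.mul_mem (ih p.1 (by omega)) (ih p.2 (by omega))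
      have ha' : (if n = 0 then a else 0) ∈ A := by split_ifs <;> simp [ha]
      have hmem := A.smul_mem (A.add_mem (A.add_mem ha' (A.mul_mem hb (ih n (by omega))))
        (A.mul_mem hc hsum)) (((n + 2) * (n + 1) : ℚ)⁻¹)
      convert hmem using 1
      ext i
      simp only [(hw i).coeff_add_two, Pi.smul_apply, Pi.add_apply, Pi.mul_apply,
        Finset.sum_apply, Rat.smul_def, div_eq_inv_mul, ite_apply, Pi.zero_apply]
      push_cast
      rfl

variable [PartialOrder F] [IsStrictOrderedRing F] [PosMulReflectLT F] {a b c : F} {w : F⟦X⟧}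

theorem coeff_nonneg (ha : 0 ≤ a) (hb : 0 ≤ b) (hc : 0 ≤ c) (hw : SolvesQuadratic a b c w)
    (n : ℕ) : 0 ≤ coeff n w := by
  induction n using Nat.strong_induction_on with
  | _ n ih =>
    match n with
    | 0 => exact hw.coeff_zero.ge
    | 1 => exact hw.coeff_one.ge
    | n + 2 =>
      have hsum : 0 ≤ ∑ p ∈ antidiagonal n, coeff p.1 w * coeff p.2 w := by
        refine Finset.sum_nonneg fun p hp => ?_
        have := mem_antidiagonal.1 hp
        exact mul_nonneg (ih p.1 (by omega)) (ih p.2 (by omega))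
      have := ih n (by omega)
      rw [hw.coeff_add_two]
      split_ifs <;> positivity

theorem coeff_two_mul_pos (ha : 0 < a) (hb : 0 < b) (hc : 0 ≤ c) (hw : SolvesQuadratic a b c w)
    {j : ℕ} (hj : 1 ≤ j) : 0 < coeff (2 * j) w := by
  have hnonneg := hw.coeff_nonneg ha.le hb.le hc
  have hsum (n : ℕ) : 0 ≤ ∑ p ∈ antidiagonal n, coeff p.1 w * coeff p.2 w :=
    Finset.sum_nonneg fun p _ => mul_nonneg (hnonneg _) (hnonneg _)
  induction j, hj using Nat.le_induction with
  | base =>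
    rw [mul_one, hw.coeff_add_two 0, if_pos rfl]
    have := hsum 0
    have := hnonneg 0
    positivity
  | succ j hj ih =>
    rw [mul_add_one, hw.coeff_add_two, if_neg (by omega), zero_add]
    have := hsum (2 * j)
    positivity

end Field

end SolvesQuadratic

section PowerSeries

variable {R : Type*} [CommRing R]

instance [CharZero R] : CharZero R⟦X⟧ := charZero_of_injective_ringHom C_injective

theorem derivative_ofNat (n : ℕ) [n.AtLeastTwo] : d⁄dX R (ofNat(n) : R⟦X⟧) = 0 :=
  (d⁄dX R).map_natCast n

theorem constantCoeff_rescale (r : R) (w : R⟦X⟧) :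
    constantCoeff (rescale r w) = constantCoeff w := by
  rw [← coeff_zero_eq_constantCoeff_apply, coeff_rescale, pow_zero, one_mul,
    coeff_zero_eq_constantCoeff_apply]

theorem constantCoeff_derivative (w : R⟦X⟧) : constantCoeff (d⁄dX R w) = coeff 1 w := by
  simpa using constantCoeff_iterate_derivative w 1

theorem derivative_inv_one_sub {F : Type*} [Field F] (a : F) (y : F⟦X⟧) :
    d⁄dX F (1 - C a * y)⁻¹ = C a * (1 - C a * y)⁻¹ ^ 2 * d⁄dX F y := by
  simp only [derivative_inv', map_sub, derivative_one, Derivation.leibniz, derivative_C,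
    smul_eq_mul]
  ring

end PowerSeries

/-- `y` is the expansion at `0` of the square of a solution `s` of
`s'² = (1 - a s²) (1 - b s²)`, `s(0) = 0`. It is `sn²(z, k)` for `{a, b} = {1, k²}`; keeping both
parameters makes the symmetry between `1 - sn²` and `1 - k² sn²` visible. -/
structure IsSnSq {F : Type*} [Field F] (a b : F) (y : F⟦X⟧) : Prop where
  constantCoeff_eq_zero : constantCoeff y = 0
  ne_zero : y ≠ 0
  derivative_sq : d⁄dX F y ^ 2 = 4 * y * (1 - C a * y) * (1 - C b * y)

namespace IsSnSq

variable {F : Type*} [Field F] {a b : F} {y : F⟦X⟧}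

theorem symm (hy : IsSnSq a b y) : IsSnSq b a y :=
  ⟨hy.constantCoeff_eq_zero, hy.ne_zero, by rw [hy.derivative_sq]; ring⟩

theorem one_sub_mul_inv (hy : IsSnSq a b y) : (1 - C a * y) * (1 - C a * y)⁻¹ = 1 :=
  PowerSeries.mul_inv_cancel _ (by simp [hy.constantCoeff_eq_zero])

theorem one_sub_ne_zero (hy : IsSnSq a b y) : 1 - C a * y ≠ 0 :=
  left_ne_zero_of_mul_eq_one hy.one_sub_mul_inv

theorem rescale_inv {t : F} (ht : t ≠ 0) (h0 : constantCoeff y = 0) (hne : y ≠ 0)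
    (hy : d⁄dX F y ^ 2 = C t ^ 2 * (4 * y * (1 - C a * y) * (1 - C b * y))) :
    IsSnSq a b (rescale t⁻¹ y) where
  constantCoeff_eq_zero := by rw [constantCoeff_rescale, h0]
  ne_zero := (map_ne_zero_iff _ (rescale_injective (inv_ne_zero ht))).2 hne
  derivative_sq := by
    have hC : (C t⁻¹ : F⟦X⟧) * C t = 1 := by rw [← map_mul, inv_mul_cancel₀ ht, map_one]
    have h := congrArg (rescale t⁻¹) hy
    simp only [map_mul, map_sub, map_pow, map_one, map_ofNat, rescale_C] at h
    rw [derivative_rescale, mul_pow, h, ← mul_assoc, ← mul_pow, hC, one_pow, one_mul]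

/-- `sn²(2z)` in terms of `y = sn²(z)`, from `sn(2z) = 2 sn cn dn / (1 - k² sn⁴)`. -/
noncomputable def doubling (a b : F) (y : F⟦X⟧) : F⟦X⟧ :=
  4 * y * (1 - C a * y) * (1 - C b * y) * (1 - C (a * b) * y ^ 2)⁻¹ ^ 2

theorem doubling_comm (a b : F) (y : F⟦X⟧) : doubling a b y = doubling b a y := by
  rw [doubling, doubling, mul_comm a b]
  ring

theorem one_sub_sq_mul_inv (hy : IsSnSq a b y) :
    (1 - C (a * b) * y ^ 2) * (1 - C (a * b) * y ^ 2)⁻¹ = 1 :=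
  PowerSeries.mul_inv_cancel _ (by simp [hy.constantCoeff_eq_zero])

theorem one_sub_doubling (hy : IsSnSq a b y) : 1 - C a * doubling a b y =
    ((1 - C (a * b) * y ^ 2)⁻¹ * (1 - 2 * C a * y + C (a * b) * y ^ 2)) ^ 2 := by
  have hq := hy.one_sub_sq_mul_inv
  rw [doubling]
  generalize (1 - C (a * b) * y ^ 2)⁻¹ = q at hq ⊢
  rw [map_mul] at *
  linear_combination -((1 - C a * C b * y ^ 2) * q + 1) * hq

theorem derivative_doubling (hy : IsSnSq a b y) :
    d⁄dX F (doubling a b y) = 4 * d⁄dX F y * (1 - C (a * b) * y ^ 2)⁻¹ ^ 3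
      * (1 - 2 * C a * y + C (a * b) * y ^ 2) * (1 - 2 * C b * y + C (a * b) * y ^ 2) := by
  have hq := hy.one_sub_sq_mul_inv
  simp only [doubling, derivative_ofNat, derivative_one, Derivation.leibniz, map_sub,
    Derivation.leibniz_pow, derivative_C, smul_eq_mul, nsmul_eq_mul, derivative_inv']
  generalize (1 - C (a * b) * y ^ 2)⁻¹ = q at hq ⊢
  rw [map_mul] at *
  push_cast
  linear_combination -4 * d⁄dX F y * q ^ 2 * (1 - 2 * (C a + C b) * y + 3 * C a * C b * y ^ 2) * hq

variable [CharZero F]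

theorem derivative_ne_zero (hy : IsSnSq a b y) : d⁄dX F y ≠ 0 := by
  rw [← pow_ne_zero_iff two_ne_zero, hy.derivative_sq]
  simp [hy.ne_zero, hy.one_sub_ne_zero, hy.symm.one_sub_ne_zero]

theorem solvesQuadratic (hy : IsSnSq a b y) :
    SolvesQuadratic 2 (-4 * (a + b)) (6 * (a * b)) y where
  coeff_zero := by rw [coeff_zero_eq_constantCoeff_apply, hy.constantCoeff_eq_zero]
  coeff_one := by
    have h := congrArg constantCoeff hy.derivative_sq
    simpa [hy.constantCoeff_eq_zero, constantCoeff_derivative] using h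
  derivative_derivative := by
    apply mul_left_cancel₀ (mul_ne_zero two_ne_zero hy.derivative_ne_zero)
    have h := congrArg (d⁄dX F) hy.derivative_sq
    simp only [derivative_ofNat, derivative_one, Derivation.leibniz, Derivation.leibniz_pow,
      derivative_C, smul_eq_mul, nsmul_eq_mul, mul_zero, add_zero, map_sub, zero_sub] at h
    simp only [map_mul, map_add, map_neg, map_ofNat]
    push_cast at h
    linear_combination h

protected theorem eq {y' : F⟦X⟧} (hy : IsSnSq a b y) (hy' : IsSnSq a b y') : y = y' :=
  hy.solvesQuadratic.eq hy'.solvesQuadratic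

theorem coeff_two (hy : IsSnSq a b y) : coeff 2 y = 1 := by
  have h := hy.solvesQuadratic.coeff_add_two 0
  simpa [hy.constantCoeff_eq_zero] using h

theorem solvesQuadratic_inv (hy : IsSnSq a b y) :
    SolvesQuadratic (2 * a) (8 * a - 4 * b) (6 * (a - b)) ((1 - C a * y)⁻¹ - 1) where
  coeff_zero := by simp [hy.constantCoeff_eq_zero]
  coeff_one := by
    rw [← constantCoeff_derivative, map_sub, derivative_one, sub_zero, derivative_inv_one_sub,
      map_mul, constantCoeff_derivative, hy.solvesQuadratic.coeff_one, mul_zero]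
  derivative_derivative := by
    have hn : C a * y * (1 - C a * y)⁻¹ = (1 - C a * y)⁻¹ - 1 := by
      linear_combination -hy.one_sub_mul_inv
    simp only [map_sub, derivative_one, sub_zero, derivative_inv_one_sub, Derivation.leibniz,
      Derivation.leibniz_pow, derivative_C, smul_eq_mul, nsmul_eq_mul,
      hy.solvesQuadratic.derivative_derivative, map_mul, map_add, map_neg, map_ofNat, mul_zero]
    generalize (1 - C a * y)⁻¹ = n at hn ⊢
    push_cast
    calc _ = 8 * (C a * y * n) * (n - C a * y * n) * (C a * n - C b * (C a * y * n))
          + 2 * C a * n ^ 2 - 4 * (C a + C b) * (C a * y * n) * n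
          + 6 * C b * (C a * y * n) ^ 2 := by
          linear_combination 2 * C a ^ 2 * n ^ 3 * hy.derivative_sq
      _ = _ := by rw [hn]; ring

theorem doubling_ne_zero (hy : IsSnSq a b y) : doubling a b y ≠ 0 :=
  mul_ne_zero (by simp [hy.ne_zero, hy.one_sub_ne_zero, hy.symm.one_sub_ne_zero])
    (pow_ne_zero 2 (right_ne_zero_of_mul_eq_one hy.one_sub_sq_mul_inv))

theorem rescale_two (hy : IsSnSq a b y) : rescale 2 y = doubling a b y := by
  have hderiv : d⁄dX F (doubling a b y) ^ 2 = C 2 ^ 2 *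
      (4 * doubling a b y * (1 - C a * doubling a b y) * (1 - C b * doubling a b y)) := by
    have hb := hy.symm.one_sub_doubling
    rw [doubling_comm, mul_comm b a] at hb
    rw [hy.derivative_doubling, hy.one_sub_doubling, hb, doubling, map_ofNat]
    generalize (1 - C (a * b) * y ^ 2)⁻¹ = q
    linear_combination 16 * q ^ 6 * (1 - 2 * C a * y + C (a * b) * y ^ 2) ^ 2
      * (1 - 2 * C b * y + C (a * b) * y ^ 2) ^ 2 * hy.derivative_sq
  have hhalf : IsSnSq a b (rescale 2⁻¹ (doubling a b y)) :=
    rescale_inv two_ne_zero (by simp [doubling, hy.constantCoeff_eq_zero])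
      hy.doubling_ne_zero hderiv
  rw [hy.eq hhalf, rescale_rescale, inv_mul_cancel₀ two_ne_zero, rescale_one, RingHom.id_apply,
    ← hy.eq hhalf]

/-- As `ns²` has the expansion `v / X²`, this is its duplication formula
`4 ns²(2z) = ns²(z) + (a + b) + ab sn²(z) + (a - b) (1 / (1 - a sn²(z)) - 1 / (1 - b sn²(z)))`. -/
theorem rescale_two_of_mul_eq_X_sq (hy : IsSnSq a b y) {v : F⟦X⟧} (hv : v * y = X ^ 2) :
    rescale 2 v = v + X ^ 2 * (C (a + b) + C (a * b) * y
      + C (a - b) * ((1 - C a * y)⁻¹ - (1 - C b * y)⁻¹)) := by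
  have hm := hy.one_sub_mul_inv
  have hn := hy.symm.one_sub_mul_inv
  have hq := hy.one_sub_sq_mul_inv
  have hq0 := right_ne_zero_of_mul_eq_one hq
  have h2v : rescale 2 v * ((1 - C a * y) * (1 - C b * y)) = v * (1 - C (a * b) * y ^ 2) ^ 2 := by
    have h := congrArg (rescale 2) hv
    rw [map_mul, map_pow, hy.rescale_two, rescale_X, doubling] at h
    generalize (1 - C (a * b) * y ^ 2)⁻¹ = q at h hq hq0
    apply mul_right_cancel₀ (by simp [hy.ne_zero, hq0] : 4 * y * q ^ 2 ≠ 0)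
    rw [map_ofNat] at h
    linear_combination h - 4 * hv - 4 * v * y * ((1 - C (a * b) * y ^ 2) * q + 1) * hq
  apply mul_right_cancel₀ (mul_ne_zero hy.one_sub_ne_zero hy.symm.one_sub_ne_zero)
  rw [h2v, ← hv]
  generalize (1 - C a * y)⁻¹ = m at hm ⊢
  generalize (1 - C b * y)⁻¹ = n at hn ⊢
  simp only [map_mul, map_add, map_sub]
  linear_combination (C b - C a) * v * y * (1 - C b * y) * hm
    + (C a - C b) * v * y * (1 - C a * y) * hn

theorem exists_mul_eq_X_sq (hy : IsSnSq a b y) : ∃ v, constantCoeff v = 1 ∧ v * y = X ^ 2 := by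
  obtain ⟨u, rfl⟩ : X ^ 2 ∣ y := X_pow_dvd_iff.2 fun n hn => by
    interval_cases n
    exacts [hy.solvesQuadratic.coeff_zero, hy.solvesQuadratic.coeff_one]
  have hu : constantCoeff u = 1 := by simpa [coeff_X_pow_mul'] using hy.coeff_two
  refine ⟨u⁻¹, by rw [constantCoeff_inv, hu, inv_one], ?_⟩
  rw [mul_left_comm, PowerSeries.inv_mul_cancel u (by simp [hu]), mul_one]

theorem exists_laurent_inv (hy : IsSnSq a b y) : ∃ g : F⟦X⟧,
    (1 + X ^ 2 * (C ((a + b) / 3) + g)) * y = X ^ 2 ∧ constantCoeff g = 0 ∧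
    4 * rescale 2 g = g + C (a * b) * y
      + C (a - b) * ((1 - C a * y)⁻¹ - (1 - C b * y)⁻¹) := by
  obtain ⟨v, hv0, hv⟩ := hy.exists_mul_eq_X_sq
  have hdouble := hy.rescale_two_of_mul_eq_X_sq hv
  obtain ⟨h, hh⟩ : X ^ 2 ∣ v - 1 := X_pow_dvd_iff.2 fun n hn => by
    interval_cases n
    · simp [hv0]
    · have hv1 := congrArg (coeff 1) hdouble
      simp only [coeff_rescale, map_add, coeff_X_pow_mul'] at hv1
      norm_num [coeff_one] at hv1 ⊢
      linear_combination hv1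
  obtain rfl : v = 1 + X ^ 2 * h := by linear_combination hh
  have hdouble' : 4 * rescale 2 h = h + C (a + b) + C (a * b) * y
      + C (a - b) * ((1 - C a * y)⁻¹ - (1 - C b * y)⁻¹) := by
    apply mul_left_cancel₀ (pow_ne_zero 2 X_ne_zero)
    simp only [map_add, map_mul, map_pow, map_one, rescale_X, map_ofNat] at hdouble ⊢
    linear_combination hdouble
  have hthree : (C (a + b) : F⟦X⟧) = 3 * C ((a + b) / 3) := by
    rw [← map_ofNat C 3, ← map_mul, mul_div_cancel₀ _ three_ne_zero]
  have hg : 4 * rescale 2 (h - C ((a + b) / 3)) = h - C ((a + b) / 3) + C (a * b) * y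
      + C (a - b) * ((1 - C a * y)⁻¹ - (1 - C b * y)⁻¹) := by
    rw [map_sub, rescale_C]
    linear_combination hdouble' + hthree
  refine ⟨_, by rw [add_sub_cancel, hv], ?_, hg⟩
  have h0 := congrArg constantCoeff hg
  simp only [map_add, map_mul, constantCoeff_rescale, constantCoeff_C, constantCoeff_inv, map_sub,
    map_one, map_ofNat, hy.constantCoeff_eq_zero] at h0 ⊢
  linear_combination h0 / 3

end IsSnSq

/-- `g` is analytic at `0` with Taylor series `p`. -/
structure HasTaylorSeries (g : ℂ → ℂ) (p : ℂ⟦X⟧) : Prop where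
  analyticAt : AnalyticAt ℂ g 0
  taylorCoeff_eq (n : ℕ) : taylorCoeff g n = coeff n p

namespace HasTaylorSeries

variable {g h : ℂ → ℂ} {p q : ℂ⟦X⟧}

theorem mk_taylorCoeff (hg : AnalyticAt ℂ g 0) :
    HasTaylorSeries g (PowerSeries.mk (taylorCoeff g)) :=
  ⟨hg, fun _ => (coeff_mk _ _).symm⟩

theorem unique (hp : HasTaylorSeries g p) (hq : HasTaylorSeries g q) : p = q := by
  ext n
  rw [← hp.taylorCoeff_eq, hq.taylorCoeff_eq]

theorem congr (hg : HasTaylorSeries g p) (hgh : g =ᶠ[𝓝 0] h) : HasTaylorSeries h p :=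
  ⟨hg.analyticAt.congr hgh, fun n => by
    rw [← hg.taylorCoeff_eq, taylorCoeff, taylorCoeff, hgh.iteratedDeriv_eq]⟩

theorem apply_zero (hg : HasTaylorSeries g p) : g 0 = constantCoeff p := by
  have h := hg.taylorCoeff_eq 0
  simpa [taylorCoeff] using h

theorem const (a : ℂ) : HasTaylorSeries (fun _ => a) (C a) where
  analyticAt := analyticAt_const
  taylorCoeff_eq n := by cases n <;> simp [taylorCoeff, coeff_C, iteratedDeriv_const]

protected theorem id : HasTaylorSeries (fun z => z) X where
  analyticAt := analyticAt_id
  taylorCoeff_eq n := by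
    rcases n with _ | _ | n <;> simp [taylorCoeff, coeff_X, iteratedDeriv_fun_id]

theorem sub (hg : HasTaylorSeries g p) (hh : HasTaylorSeries h q) :
    HasTaylorSeries (fun z => g z - h z) (p - q) where
  analyticAt := hg.analyticAt.sub hh.analyticAt
  taylorCoeff_eq n := by
    rw [map_sub, ← hg.taylorCoeff_eq, ← hh.taylorCoeff_eq, taylorCoeff, taylorCoeff, taylorCoeff,
      iteratedDeriv_fun_sub hg.analyticAt.contDiffAt hh.analyticAt.contDiffAt, sub_div]

theorem mul (hg : HasTaylorSeries g p) (hh : HasTaylorSeries h q) :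
    HasTaylorSeries (fun z => g z * h z) (p * q) where
  analyticAt := hg.analyticAt.mul hh.analyticAt
  taylorCoeff_eq n := by
    rw [coeff_mul, taylorCoeff,
      iteratedDeriv_fun_mul hg.analyticAt.contDiffAt hh.analyticAt.contDiffAt, Finset.sum_div,
      Finset.Nat.sum_antidiagonal_eq_sum_range_succ (fun i j => coeff i p * coeff j q)]
    refine Finset.sum_congr rfl fun i hi => ?_
    have hi' : i ≤ n := Nat.lt_succ_iff.1 (Finset.mem_range.1 hi)
    have hfact (m : ℕ) : (m.factorial : ℂ) ≠ 0 := by exact_mod_cast m.factorial_ne_zero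
    rw [← hg.taylorCoeff_eq, ← hh.taylorCoeff_eq, taylorCoeff, taylorCoeff,
      Nat.cast_choose ℂ hi', div_mul_div_comm]
    field_simp [hfact]

theorem pow (hg : HasTaylorSeries g p) : ∀ n, HasTaylorSeries (fun z => g z ^ n) (p ^ n)
  | 0 => by simpa only [pow_zero, map_one] using const 1
  | n + 1 => by simpa only [pow_succ] using (hg.pow n).mul hg

theorem inv (hg : HasTaylorSeries g p) (hp : constantCoeff p ≠ 0) :
    HasTaylorSeries (fun z => (g z)⁻¹) p⁻¹ := by
  have hg0 : g 0 ≠ 0 := hg.apply_zero ▸ hp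
  have hinv := mk_taylorCoeff (hg.analyticAt.fun_inv hg0)
  have hmul : (fun z => (g z)⁻¹ * g z) =ᶠ[𝓝 0] fun _ => 1 := by
    filter_upwards [hg.analyticAt.continuousAt.eventually_ne hg0] with z hz
    exact inv_mul_cancel₀ hz
  rwa [(eq_inv_iff_mul_eq_one hp).2 (((hinv.mul hg).congr hmul).unique (const 1))] at hinv

protected theorem deriv (hg : HasTaylorSeries g p) : HasTaylorSeries (deriv g) (d⁄dX ℂ p) where
  analyticAt := hg.analyticAt.deriv
  taylorCoeff_eq n := by
    rw [coeff_derivative, ← hg.taylorCoeff_eq, taylorCoeff, taylorCoeff, iteratedDeriv_succ',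
      Nat.factorial_succ]
    have h1 : (n.factorial : ℂ) ≠ 0 := by exact_mod_cast n.factorial_ne_zero
    have h2 : (n + 1 : ℂ) ≠ 0 := by exact_mod_cast n.succ_ne_zero
    push_cast
    field_simp

theorem exists_eventually_eq_pow_mul {n : ℕ} (hg : HasTaylorSeries g (X ^ n * p)) :
    ∃ h, HasTaylorSeries h p ∧ ∀ᶠ z in 𝓝 0, g z = z ^ n * h z := by
  have horder : (n : ℕ∞) ≤ analyticOrderAt g 0 := by
    rw [natCast_le_analyticOrderAt_iff_iteratedDeriv_eq_zero hg.analyticAt]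
    intro i hi
    have h := hg.taylorCoeff_eq i
    rw [coeff_X_pow_mul', if_neg hi.not_ge, taylorCoeff, div_eq_zero_iff] at h
    exact h.resolve_right (by exact_mod_cast i.factorial_ne_zero)
  obtain ⟨h, hh, hgh⟩ := (natCast_le_analyticOrderAt hg.analyticAt).1 horder
  simp only [sub_zero, smul_eq_mul] at hgh
  have hh' := mk_taylorCoeff hh
  have heq := (((HasTaylorSeries.id.pow n).mul hh').congr (hgh.mono fun _ hz => hz.symm)).unique hg
  rw [mul_left_cancel₀ (pow_ne_zero n X_ne_zero) heq] at hh'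
  exact ⟨h, hh', hgh⟩

end HasTaylorSeries

theorem hasDerivAt_integral_segment {E : Type*} [NormedAddCommGroup E] [NormedSpace ℂ E]
    [CompleteSpace E] {g : ℂ → E} {c w : ℂ} {r : ℝ} (hg : DifferentiableOn ℂ g (Metric.ball c r))
    (hw : w ∈ Metric.ball c r) :
    HasDerivAt (fun u => (u - c) • ∫ t in (0 : ℝ)..1, g (c + t • (u - c))) (g w) w := by
  obtain ⟨G, hG⟩ := hg.isExactOn_ball
  have hsegment {u : ℂ} (hu : u ∈ Metric.ball c r) {t : ℝ} (ht : t ∈ Set.Icc (0 : ℝ) 1) :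
      c + t • (u - c) ∈ Metric.ball c r :=
    (convex_ball c r).add_smul_sub_mem
      (Metric.mem_ball_self (Metric.pos_of_mem_ball hu)) hu ht
  refine ((hG w hw).sub_const (G c)).congr_of_eventuallyEq ?_
  filter_upwards [Metric.isOpen_ball.mem_nhds hw] with u hu
  have hcont : ContinuousOn (fun t : ℝ => g (c + t • (u - c))) (Set.Icc 0 1) :=
    hg.continuousOn.comp (by fun_prop) fun t ht => hsegment hu ht
  rw [intervalIntegral.integral_unitInterval_deriv_eq_sub hcont
    fun t ht => hG _ (hsegment hu ht), add_sub_cancel]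

theorem ellipticF_zero (k : ℂ) : ellipticF k 0 = 0 := by simp [ellipticF]

theorem eventually_hasDerivAt_ellipticF (k : ℂ) : ∀ᶠ w in 𝓝 (0 : ℂ),
    (1 - w ^ 2) * (1 - k ^ 2 * w ^ 2) ≠ 0 ∧ HasDerivAt (ellipticF k)
      (1 / ((1 - w ^ 2) * (1 - k ^ 2 * w ^ 2)) ^ (1 / 2 : ℂ)) w := by
  set p : ℂ → ℂ := fun w => (1 - w ^ 2) * (1 - k ^ 2 * w ^ 2) with hp
  have hslit : ∀ᶠ w in 𝓝 (0 : ℂ), p w ∈ Complex.slitPlane := by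
    apply (by fun_prop : ContinuousAt p 0)
    simpa [hp] using Complex.isOpen_slitPlane.mem_nhds Complex.one_mem_slitPlane
  obtain ⟨r, hr, hball⟩ := Metric.eventually_nhds_iff_ball.1 hslit
  have hdiff : DifferentiableOn ℂ (fun w => 1 / p w ^ (1 / 2 : ℂ)) (Metric.ball 0 r) := by
    intro w hw
    have hne : p w ^ (1 / 2 : ℂ) ≠ 0 := by
      simp [Complex.cpow_eq_zero_iff, Complex.slitPlane_ne_zero (hball w hw)]
    have hcpow : DifferentiableAt ℂ (fun w => p w ^ (1 / 2 : ℂ)) w :=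
      DifferentiableAt.cpow_const (by fun_prop) (hball w hw)
    exact ((differentiableAt_const (1 : ℂ)).div hcpow hne).differentiableWithinAt
  filter_upwards [Metric.ball_mem_nhds (0 : ℂ) hr] with w hw
  refine ⟨Complex.slitPlane_ne_zero (hball w hw), ?_⟩
  have hF : ellipticF k =
      fun u => (u - 0) • ∫ t in (0 : ℝ)..1, 1 / p (0 + t • (u - 0)) ^ (1 / 2 : ℂ) := by
    ext u
    simp [ellipticF, p]
  rw [hF]
  exact hasDerivAt_integral_segment hdiff hw

theorem analyticAt_sn (k : ℂ) : AnalyticAt ℂ (sn k) 0 := by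
  have h := (analyticAt_ellipticF k).analyticAt_localInverse (deriv_ellipticF_ne_zero k)
  rwa [ellipticF_zero] at h

theorem sn_zero (k : ℂ) : sn k 0 = 0 := by
  have h : sn k (ellipticF k 0) = 0 := HasStrictFDerivAt.localInverse_apply_image ..
  rwa [ellipticF_zero] at h

theorem eventually_ellipticF_sn (k : ℂ) : ∀ᶠ z in 𝓝 (0 : ℂ), ellipticF k (sn k z) = z := by
  have h : ∀ᶠ z in 𝓝 (ellipticF k 0), ellipticF k (sn k z) = z :=
    (analyticAt_ellipticF k).hasStrictDerivAt.eventually_right_inverse (deriv_ellipticF_ne_zero k)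
  rwa [ellipticF_zero] at h

theorem eventually_deriv_sn_sq (k : ℂ) : ∀ᶠ z in 𝓝 (0 : ℂ),
    deriv (sn k) z ^ 2 = (1 - sn k z ^ 2) * (1 - k ^ 2 * sn k z ^ 2) := by
  have hcont : Filter.Tendsto (sn k) (𝓝 0) (𝓝 0) := by
    simpa only [sn_zero] using (analyticAt_sn k).continuousAt.tendsto
  filter_upwards [hcont.eventually (eventually_hasDerivAt_ellipticF k),
    (eventually_ellipticF_sn k).eventually_nhds,
    (analyticAt_sn k).eventually_analyticAt] with z ⟨hne, hF⟩ hinv hsn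
  set p := (1 - sn k z ^ 2) * (1 - k ^ 2 * sn k z ^ 2)
  have hchain : 1 / p ^ (1 / 2 : ℂ) * deriv (sn k) z = 1 :=
    (hF.comp z hsn.differentiableAt.hasDerivAt).unique
      ((hasDerivAt_id z).congr_of_eventuallyEq hinv)
  have hroot : p ^ (1 / 2 : ℂ) ≠ 0 := by simp [Complex.cpow_eq_zero_iff, hne]
  rw [one_div_mul_eq_div, div_eq_one_iff_eq hroot] at hchain
  rw [hchain, ← Complex.cpow_nat_mul]
  norm_num

/-- The Taylor series of `sn²(·, k)` at `0`. -/
noncomputable def snSqSeries (k : ℂ) : ℂ⟦X⟧ := PowerSeries.mk (taylorCoeff (sn k)) ^ 2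

theorem hasTaylorSeries_snSq (k : ℂ) : HasTaylorSeries (fun z => sn k z ^ 2) (snSqSeries k) :=
  (HasTaylorSeries.mk_taylorCoeff (analyticAt_sn k)).pow 2

theorem isSnSq_snSqSeries (k : ℂ) : IsSnSq 1 (k ^ 2) (snSqSeries k) := by
  have hs := HasTaylorSeries.mk_taylorCoeff (analyticAt_sn k)
  rw [snSqSeries]
  generalize PowerSeries.mk (taylorCoeff (sn k)) = s at hs ⊢
  have hs0 : constantCoeff s = 0 := by rw [← hs.apply_zero, sn_zero]
  have hderiv : d⁄dX ℂ s ^ 2 = (1 - s ^ 2) * (1 - C (k ^ 2) * s ^ 2) := by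
    have hone := HasTaylorSeries.const 1
    refine (hs.deriv.pow 2).unique (((hone.sub (hs.pow 2)).mul
      (hone.sub ((HasTaylorSeries.const (k ^ 2)).mul (hs.pow 2)))).congr ?_)
    exact (eventually_deriv_sn_sq k).mono fun _ hz => hz.symm
  refine ⟨by simp [hs0], pow_ne_zero 2 ?_, ?_⟩
  · rintro rfl
    simp at hderiv
  · rw [Derivation.leibniz_pow]
    simp only [nsmul_eq_mul, smul_eq_mul, map_one]
    push_cast
    linear_combination 4 * s ^ 2 * hderiv

theorem hasTaylorSeries_dnSq (k : ℂ) :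
    HasTaylorSeries (dnSq k) (1 - C (k ^ 2) * snSqSeries k) := by
  simpa only [map_one] using! (HasTaylorSeries.const 1).sub
    ((HasTaylorSeries.const (k ^ 2)).mul (hasTaylorSeries_snSq k))

theorem hasTaylorSeries_ndSq (k : ℂ) :
    HasTaylorSeries (ndSq k) (1 - C (k ^ 2) * snSqSeries k)⁻¹ := by
  have hdn := hasTaylorSeries_dnSq k
  exact (hdn.inv (by simp [(isSnSq_snSqSeries k).constantCoeff_eq_zero])).congr
    (.of_forall fun _ => (one_div _).symm)

theorem hasTaylorSeries_ncSq (k : ℂ) : HasTaylorSeries (ncSq k) (1 - snSqSeries k)⁻¹ := by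
  have hcn := (HasTaylorSeries.const 1).sub (hasTaylorSeries_snSq k)
  rw [map_one] at hcn
  exact (hcn.inv (by simp [(isSnSq_snSqSeries k).constantCoeff_eq_zero])).congr
    (.of_forall fun _ => (one_div _).symm)

theorem hasTaylorSeries_nsSq_sub {k : ℂ} {p : ℂ⟦X⟧}
    (hp : (1 + X ^ 2 * (C ((1 + k ^ 2) / 3) + p)) * snSqSeries k = X ^ 2)
    (hp0 : constantCoeff p = 0) :
    HasTaylorSeries (Function.update (fun z => nsSq k z - 1 / z ^ 2 - (1 + k ^ 2) / 3) 0 0) p := by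
  set v := 1 + X ^ 2 * (C ((1 + k ^ 2) / 3) + p) with hv
  have hv0 : constantCoeff v ≠ 0 := by simp [hv]
  have hsn : snSqSeries k = X ^ 2 * v⁻¹ := by
    rw [← hp, mul_right_comm, PowerSeries.mul_inv_cancel v hv0, one_mul]
  obtain ⟨g, hg, hsng⟩ := (hsn ▸ hasTaylorSeries_snSq k).exists_eventually_eq_pow_mul
  have hginv0 : constantCoeff v⁻¹ ≠ 0 := by simpa using hv0
  have hvinv : v⁻¹⁻¹ = v :=
    ((PowerSeries.eq_inv_iff_mul_eq_one hginv0).2 (PowerSeries.mul_inv_cancel v hv0)).symm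
  have hquot : HasTaylorSeries (fun z => (g z)⁻¹ - 1 - (1 + k ^ 2) / 3 * z ^ 2) (X ^ 2 * p) := by
    have h := ((hg.inv hginv0).sub (.const 1)).sub
      ((HasTaylorSeries.const ((1 + k ^ 2) / 3)).mul (HasTaylorSeries.id.pow 2))
    convert h using 1
    rw [hvinv, hv, map_one]
    ring
  obtain ⟨h, hh, hgh⟩ := hquot.exists_eventually_eq_pow_mul
  refine hh.congr ?_
  filter_upwards [hsng, hgh] with z hsnz hghz
  rcases eq_or_ne z 0 with rfl | hz
  · rw [Function.update_self, hh.apply_zero, hp0]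
  · rw [Function.update_of_ne hz, nsSq, hsnz, one_div, one_div, mul_inv]
    field_simp
    linear_combination -3 * hghz

/-- The Taylor series at `0` of `k² sn² = 1 - dn²`. -/
noncomputable def snSeries (k : ℂ) : ℂ⟦X⟧ := C (k ^ 2) * snSqSeries k

/-- The Taylor series at `0` of `dc² - 1 = (1 - k²)(nc² - 1)`. -/
noncomputable def dcSeries (k : ℂ) : ℂ⟦X⟧ := C (1 - k ^ 2) * ((1 - snSqSeries k)⁻¹ - 1)

/-- The Taylor series at `0` of `k² cd² - k² = -(1 - k²)(nd² - 1)`. -/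
noncomputable def cdSeries (k : ℂ) : ℂ⟦X⟧ :=
  C (k ^ 2 - 1) * ((1 - C (k ^ 2) * snSqSeries k)⁻¹ - 1)

theorem solvesQuadratic_snSeries (k : ℂ) :
    SolvesQuadratic (k ^ 2 * 2) (-4 * (1 + k ^ 2)) 6 (snSeries k) := by
  apply SolvesQuadratic.C_mul
  simpa only [one_mul] using (isSnSq_snSqSeries k).solvesQuadratic

theorem solvesQuadratic_dcSeries (k : ℂ) :
    SolvesQuadratic ((1 - k ^ 2) * 2) (8 - 4 * k ^ 2) 6 (dcSeries k) := by
  apply SolvesQuadratic.C_mul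
  simpa only [mul_one, map_one, one_mul] using (isSnSq_snSqSeries k).solvesQuadratic_inv

theorem solvesQuadratic_cdSeries (k : ℂ) :
    SolvesQuadratic ((k ^ 2 - 1) * (2 * k ^ 2)) (8 * k ^ 2 - 4) 6 (cdSeries k) := by
  apply SolvesQuadratic.C_mul
  simpa only [mul_one] using (isSnSq_snSqSeries k).symm.solvesQuadratic_inv

theorem f_eq_neg_coeff (j : ℕ) (k : ℂ) : f j k = -coeff (2 * j) (snSeries k) := by
  have h := (hasTaylorSeries_dnSq k).sub (.const 1)
  rw [f, h.taylorCoeff_eq, ← map_neg, snSeries, map_one]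
  congr 1
  ring

theorem e_eq_coeff (j : ℕ) (k : ℂ) : e j k = coeff (2 * j) (dcSeries k) := by
  have h := (HasTaylorSeries.const (1 - k ^ 2)).mul ((hasTaylorSeries_ncSq k).sub (.const 1))
  rw [e, h.taylorCoeff_eq, dcSeries, map_one]

theorem d_eq_neg_coeff (j : ℕ) (k : ℂ) : d j k = -coeff (2 * j) (cdSeries k) := by
  have h := (HasTaylorSeries.const (1 - k ^ 2)).mul ((hasTaylorSeries_ndSq k).sub (.const 1))
  rw [d, h.taylorCoeff_eq, cdSeries, ← neg_sub, map_neg, neg_mul, map_neg, map_one]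

theorem coeff_relation (j : ℕ) (k : ℂ) :
    (2 ^ (2 * j + 2) - 1) * c j k = e j k - d j k - f j k := by
  obtain ⟨g, hg, hg0, hdup⟩ := (isSnSq_snSqSeries k).exists_laurent_inv
  have hdup' : C 4 * rescale 2 g = g + snSeries k + dcSeries k + cdSeries k := by
    rw [map_ofNat, hdup, snSeries, dcSeries, cdSeries, ← neg_sub (1 : ℂ), map_neg]
    simp only [one_mul, map_one]
    ring
  have hcoeff := congrArg (coeff (2 * j)) hdup'
  simp only [coeff_C_mul, coeff_rescale, map_add] at hcoeff
  rw [c, (hasTaylorSeries_nsSq_sub hg hg0).taylorCoeff_eq, e_eq_coeff, d_eq_neg_coeff,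
    f_eq_neg_coeff]
  linear_combination hcoeff

theorem two_pow_sub_one_ne_zero (j : ℕ) : (2 ^ (2 * j + 2) - 1 : ℚ) ≠ 0 :=
  (sub_pos.2 (one_lt_pow₀ one_lt_two (by omega))).ne'

/-- The algebra of functions of `k` that are polynomials in `k²` with rational coefficients. -/
noncomputable def sqPolynomials : Subalgebra ℚ (ℂ → ℂ) :=
  (Polynomial.aeval fun k : ℂ => k ^ 2).range

theorem mem_sqPolynomials_iff {g : ℂ → ℂ} :
    g ∈ sqPolynomials ↔ ∃ P : Polynomial ℚ, ∀ k, g k = Polynomial.aeval (k ^ 2) P := by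
  have haeval (P : Polynomial ℚ) (k : ℂ) :
      Polynomial.aeval (fun k : ℂ => k ^ 2) P k = Polynomial.aeval (k ^ 2) P :=
    (Polynomial.aeval_algHom_apply (Pi.evalAlgHom ℚ (fun _ : ℂ => ℂ) k) _ P).symm
  simp only [sqPolynomials, AlgHom.mem_range, funext_iff, haeval, eq_comm]

theorem sq_mem_sqPolynomials : (fun k : ℂ => k ^ 2) ∈ sqPolynomials :=
  ⟨Polynomial.X, Polynomial.aeval_X _⟩

theorem f_mem_sqPolynomials (j : ℕ) : f j ∈ sqPolynomials := by
  have hsq := sq_mem_sqPolynomials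
  have h := SolvesQuadratic.coeff_mem sqPolynomials (mul_mem hsq (ofNat_mem _ 2))
    (mul_mem (neg_mem (ofNat_mem _ 4)) (add_mem (one_mem _) hsq)) (ofNat_mem _ 6)
    solvesQuadratic_snSeries (2 * j)
  exact (funext (f_eq_neg_coeff j) : f j = _) ▸ neg_mem h

theorem e_mem_sqPolynomials (j : ℕ) : e j ∈ sqPolynomials := by
  have hsq := sq_mem_sqPolynomials
  have h := SolvesQuadratic.coeff_mem sqPolynomials
    (mul_mem (sub_mem (one_mem _) hsq) (ofNat_mem _ 2))
    (sub_mem (ofNat_mem _ 8) (mul_mem (ofNat_mem _ 4) hsq)) (ofNat_mem _ 6)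
    solvesQuadratic_dcSeries (2 * j)
  exact (funext (e_eq_coeff j) : e j = _) ▸ h

theorem d_mem_sqPolynomials (j : ℕ) : d j ∈ sqPolynomials := by
  have hsq := sq_mem_sqPolynomials
  have h := SolvesQuadratic.coeff_mem sqPolynomials
    (mul_mem (sub_mem hsq (one_mem _)) (mul_mem (ofNat_mem _ 2) hsq))
    (sub_mem (mul_mem (ofNat_mem _ 8) hsq) (ofNat_mem _ 4)) (ofNat_mem _ 6)
    solvesQuadratic_cdSeries (2 * j)
  exact (funext (d_eq_neg_coeff j) : d j = _) ▸ neg_mem h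

theorem c_mem_sqPolynomials (j : ℕ) : c j ∈ sqPolynomials := by
  have hN := two_pow_sub_one_ne_zero j
  have hsmul : (2 ^ (2 * j + 2) - 1 : ℚ) • c j = e j - d j - f j := by
    ext k
    simpa [Rat.smul_def] using coeff_relation j k
  rw [(eq_inv_smul_iff₀ hN).2 hsmul]
  exact sqPolynomials.smul_mem (sub_mem (sub_mem (e_mem_sqPolynomials j) (d_mem_sqPolynomials j))
    (f_mem_sqPolynomials j)) _

theorem auxVec_mem_sqPolynomials (j : ℕ) (i : Fin 4) : auxVec j i ∈ sqPolynomials := by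
  have hc := c_mem_sqPolynomials j
  have hd := d_mem_sqPolynomials j
  have he := e_mem_sqPolynomials j
  have hf := f_mem_sqPolynomials j
  fin_cases i
  exacts [neg_mem (sub_mem hc hd), add_mem hc hd, neg_mem (sub_mem he hf), add_mem he hf]

theorem linearIndependent_triple_iff {F V : Type*} [Ring F] [AddCommGroup V] [Module F V]
    {x y z : V} : LinearIndependent F ![x, y, z] ↔
      ∀ r s t : F, r • x + s • y + t • z = 0 → r = 0 ∧ s = 0 ∧ t = 0 := by
  simp [Fintype.linearIndependent_iff, Fin.sum_univ_three, Fin.forall_fin_succ,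
    Fin.forall_fin_succ_pi]

section LinearIndependence

theorem d_eq_zero {k : ℂ} (hk : k ^ 2 = 0 ∨ k ^ 2 = 1) (j : ℕ) : d j k = 0 := by
  have ha : (k ^ 2 - 1) * (2 * k ^ 2) = 0 := by rcases hk with h | h <;> simp [h]
  have hzero : cdSeries k = 0 := (ha ▸ solvesQuadratic_cdSeries k).eq .zero
  rw [d_eq_neg_coeff, hzero, map_zero, neg_zero]

theorem e_one (j : ℕ) : e j 1 = 0 := by simp [e_eq_coeff, dcSeries]

theorem f_zero (j : ℕ) : f j 0 = 0 := by simp [f_eq_neg_coeff, snSeries]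

open scoped ComplexOrder

variable {j : ℕ}

theorem e_zero_ne_zero (hj : 1 ≤ j) : e j 0 ≠ 0 := by
  have h : SolvesQuadratic 2 8 6 (dcSeries 0) := by
    convert solvesQuadratic_dcSeries 0 using 1 <;> norm_num
  rw [e_eq_coeff]
  exact (h.coeff_two_mul_pos (by norm_num) (by norm_num) (by norm_num) hj).ne'

theorem f_one_ne_zero (hj : 1 ≤ j) : f j 1 ≠ 0 := by
  have h : SolvesQuadratic 2 8 6 (-rescale Complex.I (snSeries 1)) := by
    convert (solvesQuadratic_snSeries 1).neg_rescale Complex.I_sq using 1 <;> norm_num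
  intro hf
  have hpos := h.coeff_two_mul_pos (by norm_num) (by norm_num) (by norm_num) hj
  rw [map_neg, coeff_rescale, ← mul_neg, ← f_eq_neg_coeff, hf, mul_zero] at hpos
  exact hpos.false

theorem d_ne_zero {k : ℂ} (hk : k ^ 2 = 2) (hj : 1 ≤ j) : d j k ≠ 0 := by
  have h : SolvesQuadratic 4 12 6 (cdSeries k) := by
    convert solvesQuadratic_cdSeries k using 1 <;> norm_num [hk]
  rw [d_eq_neg_coeff, neg_ne_zero]
  exact (h.coeff_two_mul_pos (by norm_num) (by norm_num) (by norm_num) hj).ne'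

theorem linearIndependent_d_e_f (hj : 1 ≤ j) : LinearIndependent ℚ ![d j, e j, f j] := by
  obtain ⟨k, hk⟩ := IsAlgClosed.exists_pow_nat_eq (2 : ℂ) two_pos
  refine linearIndependent_triple_iff.2 fun r s t hrst => ?_
  have heval (k : ℂ) : r * d j k + s * e j k + t * f j k = 0 := by
    simpa [Rat.smul_def] using congrFun hrst k
  have hs : s = 0 := by simpa [d_eq_zero, f_zero, e_zero_ne_zero hj] using heval 0
  have ht : t = 0 := by simpa [d_eq_zero, e_one, f_one_ne_zero hj] using heval 1
  have hr : r = 0 := by simpa [hs, ht, d_ne_zero hk hj] using heval k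
  exact ⟨hr, hs, ht⟩

end LinearIndependence

theorem mem_S_iff {j : ℕ} {t : Fin 4 → ℚ} : t ∈ S j ↔ ∀ k : ℂ,
    -(t 0 : ℂ) * thetaMinus j k + t 1 * thetaPlus j k - t 2 * lambdaMinus j k
      + t 3 * lambdaPlus j k = 0 := by
  change (∑ i, t i • auxVec j i = 0) ↔ _
  rw [funext_iff]
  refine forall_congr' fun k => ?_
  simp only [Fin.sum_univ_four, Pi.add_apply, Pi.smul_apply, auxVec, Rat.smul_def, Pi.zero_apply,
    Matrix.cons_val]
  ring_nf

theorem theta_lambda_relation (j : ℕ) (k : ℂ) :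
    -(1 - 2 ^ (2 * j + 1)) * thetaMinus j k + 2 ^ (2 * j + 1) * thetaPlus j k
      - lambdaMinus j k = 0 := by
  rw [thetaMinus, thetaPlus, lambdaMinus]
  linear_combination coeff_relation j k

theorem v_mem_S (j : ℕ) : v j ∈ S j := by
  rw [mem_S_iff]
  intro k
  simp only [v, Matrix.cons_val]
  push_cast
  linear_combination theta_lambda_relation j k

theorem S_eq_span {j : ℕ} (hj : 1 ≤ j) : S j = Submodule.span ℚ {v j} := by
  refine le_antisymm (fun t ht => ?_) ((Submodule.span_singleton_le_iff_mem _ _).2 (v_mem_S j))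
  rw [mem_S_iff] at ht
  set N : ℚ := 2 ^ (2 * j + 2) - 1 with hN
  have hcomb : (N * (t 0 + t 1) - (t 1 - t 0)) • d j + (N * (t 3 - t 2) + (t 1 - t 0)) • e j
      + (N * (t 2 + t 3) - (t 1 - t 0)) • f j = 0 := by
    ext k
    have htk := ht k
    rw [thetaMinus, thetaPlus, lambdaMinus, lambdaPlus] at htk
    simp only [Pi.add_apply, Pi.smul_apply, Rat.smul_def, Pi.zero_apply, hN]
    push_cast
    linear_combination (2 ^ (2 * j + 2) - 1) * htk - (t 1 - t 0) * coeff_relation j k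
  obtain ⟨hd, he, hf⟩ := linearIndependent_triple_iff.1 (linearIndependent_d_e_f hj) _ _ _ hcomb
  have hN0 : N ≠ 0 := two_pow_sub_one_ne_zero j
  have ht3 : t 3 = 0 := by
    apply mul_left_cancel₀ hN0
    linear_combination (he + hf) / 2
  have ht2 : t 2 = t 0 + t 1 := by
    apply mul_left_cancel₀ hN0
    linear_combination hf - hd - N * ht3
  have ht0 : t 0 = t 2 * (1 - 2 ^ (2 * j + 1)) := by
    linear_combination hf / 2 - ht2 / 2 - N / 2 * ht3 + t 2 / 2 * hN
  rw [Submodule.mem_span_singleton]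
  refine ⟨t 2, funext fun i => ?_⟩
  fin_cases i
  · simp [v, ht0]
  · simp [v]
    linear_combination ht2 + ht0
  · simp [v]
  · simp [v, ht3]

theorem finrank_S {j : ℕ} (hj : 1 ≤ j) : Module.finrank ℚ (S j) = 1 := by
  rw [S_eq_span hj]
  apply finrank_span_singleton
  intro hv
  simpa [v] using congrFun hv 2

theorem x_eq_xBlock (k : ℂ) (j : ℕ) (i : Fin 4) : x k (4 * j + i + 1) = xBlock k (j + 1) i := by
  have hi := i.isLt
  have hblock : (4 * j + (i : ℕ) + 1 - 1) / 4 = j := by omega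
  have hentry : Fin.ofNat 4 (4 * j + (i : ℕ) + 1 - 1) = i := by
    ext
    simp only [Fin.val_ofNat]
    omega
  rw [x, hblock, hentry]

theorem not_linearIndependent_of_eq {a b c : ℂ} {p q : ℚ} (h : p * a + q * b = c) :
    ¬ LinearIndependent ℚ ![a, b, c] := by
  intro hli
  have hcomb : p • a + q • b + (-1 : ℚ) • c = 0 := by
    simp only [Rat.smul_def]
    push_cast
    linear_combination h
  simpa using (linearIndependent_triple_iff.1 hli _ _ _ hcomb).2.2

theorem not_linearIndependent_x_even (k : ℂ) {j : ℕ} (hj : 2 ≤ j) (hej : Even j) :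
    ¬ LinearIndependent ℚ ![x k (4 * j - 3), x k (4 * j - 2), x k (4 * j - 1)] := by
  obtain ⟨i, rfl⟩ : ∃ i, j = i + 1 := ⟨j - 1, by omega⟩
  have hblock (l : Fin 4) := x_eq_xBlock k i l
  rw [show 4 * (i + 1) - 3 = 4 * i + (0 : Fin 4) + 1 by simp; omega, hblock,
    show 4 * (i + 1) - 2 = 4 * i + (1 : Fin 4) + 1 by simp; omega, hblock,
    show 4 * (i + 1) - 1 = 4 * i + (2 : Fin 4) + 1 by simp; omega, hblock]
  apply not_linearIndependent_of_eq (p := 2 ^ (2 * i + 1) - 1) (q := 2 ^ (2 * i + 1))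
  simp only [xBlock, if_neg (by omega : i + 1 ≠ 1), if_pos hej, add_tsub_cancel_right,
    Matrix.cons_val]
  push_cast
  linear_combination (2 * K k / Real.pi) ^ (2 * (i + 1)) * theta_lambda_relation i k

theorem not_linearIndependent_x_odd (k : ℂ) {j : ℕ} (hj : 3 ≤ j) (hoj : Odd j) :
    ¬ LinearIndependent ℚ ![x k (4 * j - 3), x k (4 * j - 2), x k (4 * j)] := by
  obtain ⟨i, rfl⟩ : ∃ i, j = i + 1 := ⟨j - 1, by omega⟩
  have hblock (l : Fin 4) := x_eq_xBlock k i l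
  rw [show 4 * (i + 1) - 3 = 4 * i + (0 : Fin 4) + 1 by simp; omega, hblock,
    show 4 * (i + 1) - 2 = 4 * i + (1 : Fin 4) + 1 by simp; omega, hblock,
    show 4 * (i + 1) = 4 * i + (3 : Fin 4) + 1 by simp; omega, hblock]
  apply not_linearIndependent_of_eq (p := 2 ^ (2 * i + 1)) (q := 2 ^ (2 * i + 1) - 1)
  simp only [xBlock, if_neg (by omega : i + 1 ≠ 1), if_neg (Nat.not_even_iff_odd.2 hoj),
    add_tsub_cancel_right, Matrix.cons_val]
  push_cast
  linear_combination (2 * K k / Real.pi) ^ (2 * (i + 1)) * theta_lambda_relation i k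

end JacobiAux

theorem mainTheorem2 :
    (∀ j : ℕ, 1 ≤ j →
      (∀ i : Fin 4, ∃ P : Polynomial ℚ, ∀ k : ℂ,
        JacobiAux.auxVec j i k = Polynomial.aeval (k ^ 2) P) ∧
      JacobiAux.S j = Submodule.span ℚ {JacobiAux.v j} ∧
      Module.finrank ℚ (JacobiAux.S j) = 1) ∧
    (∀ k : ℂ, k ≠ 0 → k ≠ 1 → k ≠ -1 → ∀ j : ℕ,
      (2 ≤ j → Even j →
        ¬ LinearIndependent ℚ
          ![JacobiAux.x k (4 * j - 3), JacobiAux.x k (4 * j - 2), JacobiAux.x k (4 * j - 1)]) ∧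
      (3 ≤ j → Odd j →
        ¬ LinearIndependent ℚ
          ![JacobiAux.x k (4 * j - 3), JacobiAux.x k (4 * j - 2), JacobiAux.x k (4 * j)])) := by
  refine ⟨fun j hj => ⟨fun i => ?_, JacobiAux.S_eq_span hj, JacobiAux.finrank_S hj⟩,
    fun k _ _ _ j => ⟨JacobiAux.not_linearIndependent_x_even k,
      JacobiAux.not_linearIndependent_x_odd k⟩⟩
  exact JacobiAux.mem_sqPolynomials_iff.1 (JacobiAux.auxVec_mem_sqPolynomials j i)
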